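/- Let $X$ be a metrizable topological space, let $\beta X$ be its Stone–Čech compactification, and give the remainder $\beta X\setminus X$ the subspace topology. Then $X$ is completely metrizable (that is, there is a complete metric on $X$ inducing its topology) if and only if player 2 has a winning strategy in the game $\mathsf G_{\mathrm{fin}}(\mathcal O,\mathcal O)$ played on $\beta X\setminus X$. Here, for a topological space $Y$, the game $\mathsf G_{\mathrm{fin}}(\mathcal O,\mathcal O)$ (the Menger game) on $Y$ has innings $n=0,1,2,\dots$: in inning $n$ player 1 chooses an open covering $\mathcal U_n$ of $Y$, and then player 2 chooses a finite subset $\mathcal V_n\subseteq\mathcal U_n$. Player 2 wins the play if $\bigcup_{n}\mathcal V_n$ covers $Y$; otherwise player 1 wins. A strategy for player 2 assigns to every finite sequence $(\mathcal U_0,\dots,\mathcal U_n)$ of open coverings of $Y$ a finite subset of $\mathcal U_n$; it is winning if player 2 wins every play in which each $\mathcal V_n$ is the set that it assigns to $(\mathcal U_0,\dots,\mathcal U_n)$. -/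

import Mathlib

universe u

namespace MengerGame

/-- The collection `O` of all open coverings of the space `Y`. -/
def OpenCovering (Y : Type u) [TopologicalSpace Y] : Type u :=
  {𝒰 : Set (Set Y) // (∀ U ∈ 𝒰, IsOpen U) ∧ ⋃₀ 𝒰 = Set.univ}

/-- A strategy for player 2 in `G_fin(O, O)` on `Y`: in inning `n`, after player 1 has played the
open coverings `𝒰 0, …, 𝒰 n`, it answers with a finite subset of `𝒰 n`. -/
structure Strategy₂ (Y : Type u) [TopologicalSpace Y] where
  answer : (n : ℕ) → (Fin (n + 1) → OpenCovering Y) → Set (Set Y)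
  finite_answer : ∀ n 𝒰, (answer n 𝒰).Finite
  answer_subset : ∀ n 𝒰, answer n 𝒰 ⊆ (𝒰 (Fin.last n)).1

variable {Y : Type u} [TopologicalSpace Y]

/-- The answer of player 2 in inning `n` of the infinite play in which player 1 plays the open
coverings `𝒰 0, 𝒰 1, …` and player 2 follows `σ`. -/
def Strategy₂.play (σ : Strategy₂ Y) (𝒰 : ℕ → OpenCovering Y) (n : ℕ) : Set (Set Y) :=
  σ.answer n fun i => 𝒰 i

/-- Player 2 wins every play in which she follows `σ`: her answers together cover `Y`. -/
def Strategy₂.IsWinning (σ : Strategy₂ Y) : Prop :=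
  ∀ 𝒰 : ℕ → OpenCovering Y, ⋃₀ (⋃ n, σ.play 𝒰 n) = Set.univ

/-- Player 2 has a winning strategy in the game `G_fin(O, O)` played on `Y`. -/
def PlayerTwoHasWinningStrategy (Y : Type u) [TopologicalSpace Y] : Prop :=
  ∃ σ : Strategy₂ Y, σ.IsWinning

end MengerGame

/-- The remainder `βX ∖ X` of the Stone–Čech compactification, as a subset of `βX`. -/
def stoneCechRemainder (X : Type u) [TopologicalSpace X] : Set (StoneCech X) :=
  (Set.range (stoneCechUnit : X → StoneCech X))ᶜ

open Set Filter Topology TopologicalSpace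

namespace MengerGame

/-! ### The game on σ-compact spaces. -/

section Forward

variable {Y : Type u} [TopologicalSpace Y]

/-! A completely metrizable `X` is a `Gδ` in `βX`, so the remainder is σ-compact and player 2 covers
the `n`-th compact piece in inning `n`. Conversely, let player 1 play coverings by complements of
closed neighbourhoods of a point `x` of `X`. A finite answer misses a whole neighbourhood of `x`, so
a winning strategy gives a tree of neighbourhoods whose closures, along each branch, meet only
inside `X`. Refine it to a point-finite tree of open sets in a metric completion. A point in the
union of every level lies on a branch, by König's lemma, and compactness of `βX` forces it into `X`.
Hence `X` is a `Gδ` in its completion. -/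

theorem exists_finite_subcover {K : Set Y} (hK : IsCompact K) (𝒰 : OpenCovering Y) :
    ∃ 𝒱 ⊆ 𝒰.1, 𝒱.Finite ∧ K ⊆ ⋃₀ 𝒱 := by
  obtain ⟨t, ht, htf, hKt⟩ := hK.elim_finite_subcover_image (b := 𝒰.1) (c := id)
    (fun U hU => 𝒰.2.1 U hU) (by
      simp only [id]
      rw [← sUnion_eq_biUnion, 𝒰.2.2]
      exact subset_univ _)
  exact ⟨t, ht, htf, by rwa [sUnion_eq_biUnion]⟩

theorem playerTwoHasWinningStrategy_of_iUnion_isCompact (K : ℕ → Set Y)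
    (hK : ∀ n, IsCompact (K n)) (hKY : ⋃ n, K n = univ) : PlayerTwoHasWinningStrategy Y := by
  choose 𝒱 h𝒱 hfin hcov using fun (n : ℕ) (𝒰 : OpenCovering Y) => exists_finite_subcover (hK n) 𝒰
  refine ⟨⟨fun n 𝒰 => 𝒱 n (𝒰 (Fin.last n)), fun n 𝒰 => hfin _ _, fun n 𝒰 => h𝒱 _ _⟩,
    fun 𝒰 => eq_univ_of_forall fun y => ?_⟩
  obtain ⟨n, hn⟩ := mem_iUnion.1 (hKY.symm ▸ mem_univ y : y ∈ ⋃ n, K n)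
  obtain ⟨V, hV, hyV⟩ := hcov n (𝒰 n) hn
  exact ⟨V, mem_iUnion.2 ⟨n, by simpa [Strategy₂.play] using hV⟩, hyV⟩

end Forward

end MengerGame

/-- The image of a complete metric space under a dense inducing map into a Hausdorff space
is a `Gδ` set. -/
theorem IsDenseInducing.exists_isOpen_range_eq_iInter {X B : Type*} [MetricSpace X]
    [CompleteSpace X] [TopologicalSpace B] [T2Space B] {e : X → B} (he : IsDenseInducing e) :
    ∃ G : ℕ → Set B, (∀ n, IsOpen (G n)) ∧ range e = ⋂ n, G n := by
  let S : ℕ → Set (Set B) := fun n =>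
    {W | IsOpen W ∧ ∀ a ∈ e ⁻¹' W, ∀ b ∈ e ⁻¹' W, dist a b < 1 / ((n : ℝ) + 1)}
  refine ⟨fun n => ⋃₀ S n, fun n => isOpen_sUnion fun W hW => hW.1, Subset.antisymm ?_ ?_⟩
  · rintro _ ⟨x, rfl⟩
    refine mem_iInter.2 fun n => ?_
    have hpos : (0 : ℝ) < 1 / ((n : ℝ) + 1) / 2 := by positivity
    obtain ⟨W, hW, hWx⟩ := he.isInducing.isOpen_iff.1 (Metric.isOpen_ball (x := x)
      (ε := 1 / ((n : ℝ) + 1) / 2))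
    refine ⟨W, ⟨hW, fun a ha b hb => ?_⟩, ?_⟩
    · rw [hWx] at ha hb
      have := dist_triangle_right a b x
      rw [Metric.mem_ball] at ha hb
      linarith
    · change x ∈ e ⁻¹' W
      rw [hWx]
      exact Metric.mem_ball_self hpos
  · intro z hz
    -- The trace on `X` of the neighbourhoods of `z` contains arbitrarily small sets, so it is
    -- Cauchy; its limit is mapped to `z`.
    have : (comap e (𝓝 z)).NeBot := he.comap_nhds_neBot z
    have hc : Cauchy (comap e (𝓝 z)) := by
      refine Metric.cauchy_iff.2 ⟨this, fun ε hε => ?_⟩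
      obtain ⟨n, hn⟩ := exists_nat_one_div_lt hε
      obtain ⟨W, hW, hzW⟩ := mem_iInter.1 hz n
      exact ⟨e ⁻¹' W, preimage_mem_comap (hW.1.mem_nhds hzW),
        fun a ha b hb => (hW.2 a ha b hb).trans hn⟩
    obtain ⟨x, hx⟩ := CompleteSpace.complete hc
    have h1 : Tendsto e (comap e (𝓝 z)) (𝓝 (e x)) := (he.continuous.tendsto x).mono_left hx
    exact ⟨x, tendsto_nhds_unique h1 tendsto_comap⟩

theorem playerTwoHasWinningStrategy_stoneCechRemainder (X : Type u) [TopologicalSpace X]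
    [IsCompletelyMetrizableSpace X] :
    MengerGame.PlayerTwoHasWinningStrategy (stoneCechRemainder X) := by
  let := upgradeIsCompletelyMetrizable X
  obtain ⟨G, hG, hXG⟩ := IsDenseInducing.exists_isOpen_range_eq_iInter
    (isDenseInducing_stoneCechUnit (X := X))
  refine MengerGame.playerTwoHasWinningStrategy_of_iUnion_isCompact
    (fun n => Subtype.val ⁻¹' (G n)ᶜ) (fun n => ?_) ?_
  · rw [Subtype.isCompact_iff, Subtype.image_preimage_coe, inter_eq_right.2]
    · exact (hG n).isClosed_compl.isCompact
    · rw [stoneCechRemainder, hXG]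
      exact compl_subset_compl.2 (iInter_subset _ _)
  · rw [← preimage_iUnion, ← compl_iInter, ← hXG]
    exact eq_univ_of_forall fun y => y.2

/-- Each open `U n` is completely metrizable, and `X` embeds diagonally in their product as the
closed set where all coordinates agree in `Z`. -/
theorem Topology.IsEmbedding.isCompletelyMetrizableSpace_of_range_eq_iInter {X Z : Type*}
    [TopologicalSpace X] [MetricSpace Z] [CompleteSpace Z] {e : X → Z} (he : IsEmbedding e)
    {U : ℕ → Set Z} (hU : ∀ n, IsOpen (U n)) (hr : range e = ⋂ n, U n) :
    IsCompletelyMetrizableSpace X := by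
  have hmem : ∀ x n, e x ∈ U n := fun x n => mem_iInter.1 (hr ▸ mem_range_self x) n
  let V : ℕ → Opens Z := fun n => ⟨U n, hU n⟩
  have : ∀ n, IsCompletelyMetrizableSpace (V n) := fun n =>
    inferInstanceAs (IsCompletelyMetrizableSpace (Opens.CompleteCopy (V n)))
  let f : X → ∀ n, V n := fun x n => ⟨e x, hmem x n⟩
  have hf : Continuous f :=
    continuous_pi fun n => he.continuous.subtype_mk _
  have hcoe : ∀ n, Continuous fun g : ∀ n, V n => (g n : Z) := fun n =>
    continuous_subtype_val.comp (continuous_apply n)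
  have hrange : range f = ⋂ n, {g : ∀ n, V n | (g n : Z) = g 0} := by
    refine Subset.antisymm ?_ fun g hg => ?_
    · rintro _ ⟨x, rfl⟩
      exact mem_iInter.2 fun n => rfl
    · have hg' : ∀ n, (g n : Z) = g 0 := fun n => mem_iInter.1 hg n
      obtain ⟨x, hx⟩ : (g 0 : Z) ∈ range e := hr ▸ mem_iInter.2 fun n => hg' n ▸ (g n).2
      exact ⟨x, funext fun n => Subtype.ext (hx.trans (hg' n).symm)⟩
  have hfc : IsClosedEmbedding f :=
    ⟨IsEmbedding.of_comp hf (hcoe 0) he,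
      hrange ▸ isClosed_iInter fun n => isClosed_eq (hcoe n) (hcoe 0)⟩
  exact hfc.IsCompletelyMetrizableSpace

/-! ### Point-finite refinements and König's lemma. -/

/-- In a metrizable space every family of open sets has a precise point-finite open refinement
with the same union. -/
theorem exists_pointFinite_refinement {Z ι : Type*} [TopologicalSpace Z] [PseudoMetrizableSpace Z]
    (u : ι → Set Z) (hu : ∀ i, IsOpen (u i)) :
    ∃ v : ι → Set Z, (∀ i, IsOpen (v i)) ∧ (∀ i, v i ⊆ u i) ∧ (⋃ i, v i = ⋃ i, u i) ∧
      ∀ z, {i | z ∈ v i}.Finite := by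
  let := pseudoMetrizableSpacePseudoMetric Z
  have hU : IsOpen (⋃ i, u i) := isOpen_iUnion hu
  -- The union is itself paracompact. Local finiteness holds only relative to it, but outside it no
  -- member contains `z`.
  obtain ⟨v, hvo, hvc, hvf, hvu⟩ := precise_refinement
    (fun i => ((↑) : (⋃ i, u i : Set Z) → Z) ⁻¹' u i)
    (fun i => (hu i).preimage continuous_subtype_val)
    (eq_univ_of_forall fun z => by simpa only [mem_iUnion, mem_preimage] using mem_iUnion.1 z.2)
  have hsub : ∀ i, Subtype.val '' v i ⊆ u i := fun i => image_subset_iff.2 (hvu i)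
  refine ⟨fun i => Subtype.val '' v i, fun i => hU.isOpenMap_subtype_val _ (hvo i), hsub,
    Subset.antisymm (iUnion_mono hsub) fun z hz => ?_, fun z => ?_⟩
  · obtain ⟨i, hi⟩ := mem_iUnion.1 (hvc.symm ▸ mem_univ (⟨z, hz⟩ : (⋃ i, u i : Set Z)))
    exact mem_iUnion.2 ⟨i, _, hi, rfl⟩
  · by_cases hz : z ∈ ⋃ i, u i
    · refine (hvf.point_finite ⟨z, hz⟩).subset ?_
      rintro i ⟨y, hy, rfl⟩
      exact hy
    · refine finite_empty.subset fun i hi => hz (mem_iUnion.2 ⟨i, hsub i hi⟩)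

/-- The list of the first `n` values of `f`, the last one first. -/
def reversePrefix {α : Type*} (f : ℕ → α) : ℕ → List α
  | 0 => []
  | n + 1 => f n :: reversePrefix f n

@[simp]
theorem length_reversePrefix {α : Type*} (f : ℕ → α) (n : ℕ) : (reversePrefix f n).length = n := by
  induction n with
  | zero => rfl
  | succ n ih => simp [reversePrefix, ih]

theorem getD_reversePrefix {α : Type*} (f : ℕ → α) (a : α) {n i : ℕ} (hi : i ≤ n) :
    (reversePrefix f (n + 1)).getD (n - i) a = f i := by
  induction n with
  | zero => simp [reversePrefix, Nat.le_zero.1 hi]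
  | succ n ih =>
    rw [reversePrefix]
    rcases hi.eq_or_lt with rfl | h
    · simp
    · rw [Nat.succ_sub (Nat.lt_succ_iff.1 h), List.getD_cons_succ, ih (Nat.lt_succ_iff.1 h)]

/-- König's lemma for a finitely branching tree of finite sequences. -/
theorem exists_branch_of_finite_branching {α : Type*} (T : Set (List α))
    (hpre : ∀ a s, a :: s ∈ T → s ∈ T) (hfin : ∀ s, {a | a :: s ∈ T}.Finite)
    (hinf : ∀ n, ∃ s ∈ T, s.length = n) : ∃ f : ℕ → α, ∀ n, reversePrefix f n ∈ T := by
  have hsuf : ∀ t s : List α, t ++ s ∈ T → s ∈ T := by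
    intro t
    induction t with
    | nil => exact fun s h => h
    | cons a t ih => exact fun s h => ih s (hpre a _ h)
  let good : Set (List α) := {s | ∀ n, ∃ t : List α, n ≤ t.length ∧ t ++ s ∈ T}
  have hnil : [] ∈ good := fun n => by
    obtain ⟨s, hs, hn⟩ := hinf n
    exact ⟨s, hn.ge, by simpa using hs⟩
  have hstep : ∀ s ∈ good, ∃ a, a :: s ∈ good := by
    intro s hs
    by_contra! hcon
    have hbad : ∀ a, ∃ n, ∀ t : List α, n ≤ t.length → t ++ a :: s ∉ T := fun a => by
      simpa [good] using hcon a
    choose N hN using hbad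
    -- A descendant more than `M` levels above `s` passes through a child `a`, the last entry of
    -- `t`, and is too long for the bound `N a`.
    obtain ⟨M, hM⟩ := ((hfin s).image N).bddAbove
    obtain ⟨t, ht, hts⟩ := hs (M + 1)
    have htne : t ≠ [] := by
      rintro rfl
      simp at ht
    obtain ⟨t', a, rfl⟩ : ∃ t' a, t = t' ++ [a] := ⟨_, _, (List.dropLast_append_getLast htne).symm⟩
    rw [List.append_assoc, List.singleton_append] at hts
    refine hN a t' ?_ hts
    have : N a ≤ M := hM (mem_image_of_mem N (hsuf t' _ hts))
    simp only [List.length_append, List.length_singleton] at ht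
    omega
  have : Nonempty α := ⟨(hstep [] hnil).choose⟩
  choose! next hnext using hstep
  let s : ℕ → List α := fun n => Nat.rec [] (fun _ s => next s :: s) n
  have hs : ∀ n, s n ∈ good := fun n => by
    induction n with
    | zero => exact hnil
    | succ n ih => exact hnext _ ih
  have heq : ∀ n, reversePrefix (fun k => next (s k)) n = s n := fun n => by
    induction n with
    | zero => rfl
    | succ n ih => rw [reversePrefix, ih]
  refine ⟨fun k => next (s k), fun n => heq n ▸ ?_⟩
  obtain ⟨t, -, ht⟩ := hs n 0
  exact hsuf t _ ht

/-! ### From a winning strategy to a `Gδ` in the completion. -/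

namespace MengerGame

/-- The open covering of a subspace `Y` by the complements of the closed neighbourhoods of a point
outside `Y`. -/
def awayFrom {B : Type u} [TopologicalSpace B] [T2Space B] {Y : Set B} (b : B) (hb : b ∉ Y) :
    OpenCovering Y :=
  ⟨{U | ∃ W : Set B, IsOpen W ∧ b ∈ W ∧ U = Subtype.val ⁻¹' (closure W)ᶜ}, by
    rintro _ ⟨W, -, -, rfl⟩
    exact isClosed_closure.isOpen_compl.preimage continuous_subtype_val, by
    refine eq_univ_of_forall fun y => ?_
    obtain ⟨W, W', hW, hW', hbW, hyW', hd⟩ := t2_separation (x := b) (y := y.1)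
      (fun h => hb (h ▸ y.2))
    exact ⟨_, ⟨W, hW, hbW, rfl⟩, fun h => (hd.closure_left hW').notMem_of_mem_left h hyW'⟩⟩

theorem exists_nhd_disjoint_of_finite_subset_awayFrom {B : Type u} [TopologicalSpace B] [T2Space B]
    {Y : Set B} {b : B} (hb : b ∉ Y) {𝒱 : Set (Set Y)} (hfin : 𝒱.Finite)
    (h𝒱 : 𝒱 ⊆ (awayFrom b hb).1) :
    ∃ W : Set B, IsOpen W ∧ b ∈ W ∧ ∀ V ∈ 𝒱, ∀ y ∈ V, (y : B) ∉ closure W := by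
  choose! N hNo hbN hN using fun V (hV : V ∈ 𝒱) => h𝒱 hV
  refine ⟨⋂ V ∈ 𝒱, N V, hfin.isOpen_biInter hNo, mem_iInter₂.2 hbN, fun V hV y hy hyW => ?_⟩
  rw [hN V hV] at hy
  exact hy (closure_mono (biInter_subset_of_mem hV) hyW)

/-- A winning strategy of player 2 on the complement of the range of `e` yields a tree of
neighbourhoods of points of `X` such that the intersection of the closures along any branch is
contained in the range of `e`. -/
theorem exists_tree_of_playerTwoHasWinningStrategy {X B : Type u} [TopologicalSpace B] [T2Space B]
    (e : X → B) (h : PlayerTwoHasWinningStrategy ((range e)ᶜ : Set B)) :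
    ∃ W : List X → X → Set B, (∀ s x, IsOpen (W s x)) ∧ (∀ s x, e x ∈ W s x) ∧
      ∀ f : ℕ → X, ⋂ n, closure (W (reversePrefix f n) (f n)) ⊆ range e := by
  obtain ⟨σ, hσ⟩ := h
  let cov : X → OpenCovering ((range e)ᶜ : Set B) := fun x => awayFrom (e x) (by simp)
  -- Histories are stored latest move first, hence the index `s.length - i`; it is always in range,
  -- so the default `x` is never used.
  let ans : List X → X → Set (Set ((range e)ᶜ : Set B)) := fun s x =>
    σ.answer s.length fun i => cov ((x :: s).getD (s.length - i) x)
  have hans : ∀ s x, ans s x ⊆ (cov x).1 := fun s x => by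
    simpa [ans] using σ.answer_subset s.length fun i => cov ((x :: s).getD (s.length - i) x)
  choose W hWo hxW hW using fun s x => exists_nhd_disjoint_of_finite_subset_awayFrom _
    (σ.finite_answer s.length _ : (ans s x).Finite) (hans s x)
  refine ⟨W, hWo, hxW, fun f b hb => ?_⟩
  by_contra hbe
  obtain ⟨V, hV, hbV⟩ : (⟨b, hbe⟩ : ((range e)ᶜ : Set B)) ∈
      ⋃₀ ⋃ n, σ.play (fun n => cov (f n)) n := hσ _ ▸ mem_univ _
  obtain ⟨n, hn⟩ := mem_iUnion.1 hV
  have heq : ans (reversePrefix f n) (f n) = σ.play (fun n => cov (f n)) n := by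
    -- The inning number occurs in the type of the history, so it is generalized to `m` before
    -- substituting.
    have key : ∀ m (g : ℕ → OpenCovering ((range e)ᶜ : Set B)), m = n →
        (∀ i ≤ n, g i = cov (f i)) →
        σ.answer m (fun i => g i) = σ.answer n fun i => cov (f i) := by
      rintro m g rfl hg
      congr 1
      exact funext fun i => hg i (Nat.lt_succ_iff.1 i.2)
    refine key _ (fun i => cov ((f n :: reversePrefix f n).getD
      ((reversePrefix f n).length - i) (f n))) (length_reversePrefix f n) fun i hi => ?_
    rw [length_reversePrefix]
    exact congrArg cov (getD_reversePrefix f (f n) hi)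
  exact hW _ _ V (heq.symm.subset hn) _ hbV (mem_iInter.1 hb n)

end MengerGame

/-- A tree of neighbourhoods in `X`, pulled back from `B`, refines to a finitely branching tree of
open sets of `Z ⊇ X`, covering `X` at each level. -/
theorem exists_pointFinite_tree {X Z B : Type*} [TopologicalSpace X] [TopologicalSpace B]
    [TopologicalSpace Z] [PseudoMetrizableSpace Z] {c : X → Z} (hc : IsInducing c) {e : X → B}
    (he : Continuous e) (W : List X → X → Set B) (hWo : ∀ s x, IsOpen (W s x))
    (hxW : ∀ s x, e x ∈ W s x) :
    ∃ O : List X → Set Z, (∀ s, IsOpen (O s)) ∧ (∀ x s, O (x :: s) ⊆ O s) ∧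
      (∀ x s, c ⁻¹' O (x :: s) ⊆ e ⁻¹' W s x) ∧ (∀ s z, {x | z ∈ O (x :: s)}.Finite) ∧
      ∀ n a, ∃ s, c a ∈ O s ∧ s.length = n := by
  have hstep : ∀ (s : List X) (P : Opens Z), ∃ v : X → Opens Z, (∀ x, v x ≤ P) ∧
      (∀ x, c ⁻¹' v x ⊆ e ⁻¹' W s x) ∧ (∀ z, {x | z ∈ v x}.Finite) ∧
      ∀ a, c a ∈ P → ∃ x, c a ∈ v x := by
    intro s P
    choose u huo hu using fun x => hc.isOpen_iff.1 ((hWo s x).preimage he)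
    -- Intersecting with `P` nests children in their parent; a point `a` of `X` in `P` is still
    -- covered, by its own `u a`.
    obtain ⟨v, hvo, hvu, hvc, hvf⟩ := exists_pointFinite_refinement (fun x => u x ∩ P)
      fun x => (huo x).inter P.isOpen
    refine ⟨fun x => ⟨v x, hvo x⟩, fun x z hz => (hvu x hz).2, fun x a ha => ?_, hvf,
      fun a ha => ?_⟩
    · rw [← hu x]
      exact (hvu x ha).1
    · have hau : c a ∈ u a := by
        change a ∈ c ⁻¹' u a
        rw [hu a]
        exact hxW s a
      exact mem_iUnion.1 (hvc ▸ mem_iUnion.2 ⟨a, hau, ha⟩)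
  choose v hvP hvW hvf hvc using hstep
  let O : List X → Opens Z := fun s => List.rec ⊤ (fun x s P => v s P x) s
  refine ⟨fun s => (O s).carrier, fun s => (O s).isOpen, fun x s => hvP s (O s) x, fun x s => hvW s (O s) x,
    fun s z => hvf s (O s) z, fun n a => ?_⟩
  induction n with
  | zero => exact ⟨[], trivial, rfl⟩
  | succ n ih =>
    obtain ⟨s, hs, rfl⟩ := ih
    obtain ⟨x, hx⟩ := hvc s (O s) a hs
    exact ⟨x :: s, hx, rfl⟩

theorem isCompletelyMetrizableSpace_of_playerTwoHasWinningStrategy {X B : Type u}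
    [TopologicalSpace X] [MetrizableSpace X] [TopologicalSpace B] [CompactSpace B] [T2Space B]
    {e : X → B} (he : IsInducing e)
    (h : MengerGame.PlayerTwoHasWinningStrategy ((range e)ᶜ : Set B)) :
    IsCompletelyMetrizableSpace X := by
  let := metrizableSpaceMetric X
  obtain ⟨W, hWo, hxW, hW⟩ := MengerGame.exists_tree_of_playerTwoHasWinningStrategy e h
  have hc := UniformSpace.Completion.isDenseEmbedding_coe (α := X)
  obtain ⟨O, hOo, hOs, hOW, hOf, hOc⟩ :=
    exists_pointFinite_tree hc.isInducing he.continuous W hWo hxW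
  refine hc.isEmbedding.isCompletelyMetrizableSpace_of_range_eq_iInter
    (U := fun n => ⋃ s ∈ {s : List X | s.length = n}, O s)
    (fun n => isOpen_biUnion fun s _ => hOo s) (Subset.antisymm ?_ fun y hy => ?_)
  · rintro _ ⟨a, rfl⟩
    refine mem_iInter.2 fun n => ?_
    obtain ⟨s, hs, hn⟩ := hOc n a
    exact mem_biUnion (show s ∈ {s : List X | s.length = n} from hn) hs
  · obtain ⟨f, hf⟩ := exists_branch_of_finite_branching {s | y ∈ O s} (fun x s hx => hOs x s hx)
      (fun s => hOf s y) (fun n => by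
        obtain ⟨s, hs, hys⟩ := mem_iUnion₂.1 (mem_iInter.1 hy n)
        exact ⟨s, hys, hs⟩)
    have : (comap ((↑) : X → UniformSpace.Completion X) (𝓝 y)).NeBot :=
      hc.isDenseInducing.comap_nhds_neBot y
    -- An ultrafilter on `X` tending to `y` also converges in the compact `B`. Its limit there lies
    -- in every closure along the branch, hence in `range e`.
    let F := Ultrafilter.of (comap ((↑) : X → UniformSpace.Completion X) (𝓝 y))
    have hFy : Tendsto ((↑) : X → UniformSpace.Completion X) F (𝓝 y) :=
      tendsto_comap.mono_left (Ultrafilter.of_le _)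
    obtain ⟨b, hb⟩ : ∃ b, Tendsto e F (𝓝 b) :=
      ⟨_, (F.map e).le_nhds_lim⟩
    obtain ⟨x, rfl⟩ : b ∈ range e := hW f <| mem_iInter.2 fun n =>
      mem_closure_of_tendsto hb <|
        (hFy.eventually ((hOo _).mem_nhds (hf (n + 1)))).mono fun a ha => hOW _ _ ha
    have hFx : Tendsto ((↑) : X → UniformSpace.Completion X) F (𝓝 (x : UniformSpace.Completion X)) :=
      (hc.continuous.tendsto x).comp (he.tendsto_nhds_iff.2 hb : Tendsto id _ _)
    exact ⟨x, tendsto_nhds_unique hFx hFy⟩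

theorem corollary3p4 (X : Type u) [TopologicalSpace X] [TopologicalSpace.MetrizableSpace X] :
    TopologicalSpace.IsCompletelyMetrizableSpace X ↔
      MengerGame.PlayerTwoHasWinningStrategy (stoneCechRemainder X) :=
  ⟨fun _ => playerTwoHasWinningStrategy_stoneCechRemainder X,
    isCompletelyMetrizableSpace_of_playerTwoHasWinningStrategy isInducing_stoneCechUnit⟩
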